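/- All automorphisms below are invertible bimeasurable measure-preserving maps of standard Borel probability spaces. An automorphism $S$ of $(Y,\mathcal C,\nu)$ is weakly mixing if $S\times S$ is ergodic for $\nu\otimes\nu$. A joining of automorphisms $T$ of $(X,\mathcal B,\mu)$ and $S$ of $(Y,\mathcal C,\nu)$ is a $T\times S$-invariant probability measure on $X\times Y$ with marginals $\mu$ and $\nu$; $T$ and $S$ are disjoint if $\mu\otimes\nu$ is their only joining. For $n\ge 1$, an ergodic automorphism $R$ of $(Z,\mathcal D,\rho)$ has the property JP($n$) if for every $k\ge n+1$, all weakly mixing automorphisms $S_i$ of $(Y_i,\mathcal C_i,\nu_i)$, $1\le i\le k$, and every ergodic joining $\lambda$ of $R$ with $S_1\times\dots\times S_k$ there are $i_1,\dots,i_n\in\{1,\dots,k\}$ such that $$\lambda=\lambda_{Z,Y_{i_1},\dots,Y_{i_n}}\otimes\bigotimes_{j\notin\{i_1,\dots,i_n\}}\nu_j ,$$ where $\lambda_{Z,Y_{i_1},\dots,Y_{i_n}}$ is the projection of $\lambda$ on the product of the indicated coordinates. For an automorphism $S$ of $(Y,\mathcal C,\nu)$ and $k\ge1$, let $\mathcal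 F_k(S)$ be the $\sigma$-algebra of all sets in $\mathcal C^{\otimes k}$ that are invariant under all permutations of the $k$ coordinates (the symmetric factor of $S^{\times k}$). \textbf{Proposition.} Fix $n\ge 1$ and let $T$ be an automorphism of a standard Borel probability space $(X,\mathcal B,\mu)$. Assume that for each $g\in L^2(X,\mathcal B,\mu)$ there exist a sequence of positive integers $k_j\to\infty$, a sequence of weakly mixing automorphisms $S_j$ of standard Borel probability spaces $(Y_j,\mathcal C_j,\nu_j)$, and factor maps $\pi_j\colon Y_j^{k_j}\to X$ from $S_j^{\times k_j}$ onto $T$ (that is, $\pi_j$ is measurable, sends $\nu_j^{\otimes k_j}$ to $\mu$, and $\pi_j\circ S_j^{\times k_j}=T\circ\pi_j$ almost everywhere) such that $$\operatorname{dist}\bigl(g\circ\pi_j,\;L^2(\mathcal F_{k_j}(S_j))\bigr)=o\bigl(k_j^{-n/2}\bigr)\quad\text{as } j\to\infty,$$ the distance being taken in $L^2(Y_j^{k_j},\nu_j^{\otimes k_j})$. Then $T$ is disjoint from every automorphism with the property JP($n$). (This holds with $L^2$ meaning real or complex $L^2$ throughout.) -/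

import Mathlib

open MeasureTheory Filter Asymptotics

universe u v w

namespace JoiningPrimeness

/-- `S` is a weakly mixing automorphism of the probability space `(Y, ν)`:
it preserves `ν` and `S × S` is ergodic with respect to `ν ⊗ ν`. -/
structure IsWeaklyMixing {Y : Type u} [MeasurableSpace Y] (S : Y ≃ᵐ Y) (ν : Measure Y) :
    Prop where
  measurePreserving : MeasurePreserving S ν ν
  ergodic_prod : Ergodic (Prod.map S S) (ν.prod ν)

/-- `κ` is a joining of `(X, μ, T)` and `(Y, ν, S)`. -/
structure IsJoining {X : Type u} {Y : Type v} [MeasurableSpace X] [MeasurableSpace Y]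
    (T : X → X) (μ : Measure X) (S : Y → Y) (ν : Measure Y) (κ : Measure (X × Y)) : Prop where
  map_fst : κ.map Prod.fst = μ
  map_snd : κ.map Prod.snd = ν
  invariant : MeasurePreserving (Prod.map T S) κ κ

/-- The set `J(T, S)` of all joinings. -/
def joinings {X : Type u} {Y : Type v} [MeasurableSpace X] [MeasurableSpace Y]
    (T : X → X) (μ : Measure X) (S : Y → Y) (ν : Measure Y) : Set (Measure (X × Y)) :=
  {κ | IsJoining T μ S ν κ}

/-- `T` and `S` are disjoint: the product measure is their only joining. -/
def AreDisjoint {X : Type u} {Y : Type v} [MeasurableSpace X] [MeasurableSpace Y]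
    (T : X → X) (μ : Measure X) (S : Y → Y) (ν : Measure Y) : Prop :=
  joinings T μ S ν = {μ.prod ν}

/-- For a measure `κ` on `X × ∏ i, Y i` and a set `I` of coordinates:
`κ = κ_{X, (Y i)_{i ∈ I}} ⊗ ⨂_{j ∉ I} ν j`, up to the obvious reordering of coordinates. -/
def IsIndepExtension {X : Type u} [MeasurableSpace X] {k : ℕ} {Y : Fin k → Type v}
    [∀ i, MeasurableSpace (Y i)] (ν : ∀ i, Measure (Y i)) (κ : Measure (X × (∀ i, Y i)))
    (I : Finset (Fin k)) : Prop :=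
  κ.map (fun p => ((p.1, fun i : {i // i ∈ I} => p.2 i), fun j : {j // j ∉ I} => p.2 j)) =
    (κ.map (fun p => (p.1, fun i : {i // i ∈ I} => p.2 i))).prod
      (Measure.pi fun j : {j // j ∉ I} => ν j)

/-- The joining primeness property of order `n` of an automorphism `R` of a standard probability
space `(Z, ρ)`. -/
structure JP {Z : Type v} [MeasurableSpace Z] (n : ℕ) (R : Z ≃ᵐ Z) (ρ : Measure Z) : Prop where
  ergodic : Ergodic R ρ
  exists_isIndepExtension : ∀ (k : ℕ), n + 1 ≤ k →
    ∀ (Y : Fin k → Type w) [∀ i, MeasurableSpace (Y i)] [∀ i, StandardBorelSpace (Y i)]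
      (ν : ∀ i, Measure (Y i)) [∀ i, IsProbabilityMeasure (ν i)] (S : ∀ i, Y i ≃ᵐ Y i),
      (∀ i, IsWeaklyMixing (S i) (ν i)) →
      ∀ κ : Measure (Z × (∀ i, Y i)),
        IsJoining R ρ (Pi.map fun i => S i) (Measure.pi ν) κ →
        Ergodic (Prod.map R (Pi.map fun i => S i)) κ →
        ∃ i : Fin n → Fin k, IsIndepExtension ν κ (Finset.univ.image i)

/-- `π` is a factor map from `(Y, ν, S)` onto `(X, μ, T)`. -/
structure IsFactorMap {Y : Type u} {X : Type v} [MeasurableSpace Y] [MeasurableSpace X]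
    (S : Y → Y) (ν : Measure Y) (T : X → X) (μ : Measure X) (π : Y → X) : Prop where
  measurePreserving : MeasurePreserving π ν μ
  equivariant : π ∘ S =ᵐ[ν] T ∘ π

/-- The symmetric factor: the σ-algebra of all measurable subsets of `Y ^ k` that are invariant
under all permutations of the coordinates. -/
@[reducible]
def symmetricFactor (Y : Type u) [MeasurableSpace Y] (k : ℕ) : MeasurableSpace (Fin k → Y) where
  MeasurableSet' A := MeasurableSet A ∧
    ∀ σ : Equiv.Perm (Fin k), (fun y : Fin k → Y => y ∘ σ) ⁻¹' A = A
  measurableSet_empty := ⟨MeasurableSet.empty, fun _ => rfl⟩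
  measurableSet_compl A hA :=
    ⟨hA.1.compl, fun σ => by rw [Set.preimage_compl, hA.2 σ]⟩
  measurableSet_iUnion f hf :=
    ⟨MeasurableSet.iUnion fun i => (hf i).1, fun σ => by
      rw [Set.preimage_iUnion]; exact Set.iUnion_congr fun i => (hf i).2 σ⟩

/-- The `L²`-distance from `G ∈ L²(Y ^ k, ν^{⊗ k})` to the subspace of (classes of) functions that
are measurable with respect to the symmetric factor. -/
noncomputable def distSymmetric {𝕜 : Type*} [RCLike 𝕜] {Y : Type u} [MeasurableSpace Y] {k : ℕ}
    {ν : Measure Y} (G : Lp 𝕜 2 (Measure.pi fun _ : Fin k => ν)) : ℝ :=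
  Metric.infDist G
    (lpMeas 𝕜 𝕜 (symmetricFactor Y k) 2 (Measure.pi fun _ : Fin k => ν) : Set _)

end JoiningPrimeness

open JoiningPrimeness

/-!
A joining `κ` of `T` and `R` lifts through `π : Y ^ k → X` to the joining of `R` and `S ^ k` that is
relatively independent over it, and `κ (B × A)` is the measure of `A × π⁻¹ B` for the lift. The
ergodic components of the lift are joinings again, since both marginals are ergodic, so by `JP n`
each of them depends on at most `n` of the `k` coordinates of `Y ^ k`. Hence the conditional
expectation of `1_A` on `Y ^ k` is a function `h` of these coordinates only. The set `π⁻¹ B` is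
almost invariant under permutations, so its correlation with `h` hardly changes when the
coordinates are moved to any of about `k / n` disjoint blocks. The corresponding copies of `h` are
independent, so their average is close to the constant `∫ h` in `L²`, and the correlation is close
to a product. Letting `k → ∞` gives `κ (B × A) = μ B * ρ A`.
-/

open ProbabilityTheory
open scoped ENNReal Topology

namespace JoiningPrimeness

section MeanErgodic

variable {Ω : Type*} [mΩ : MeasurableSpace Ω] {μ : Measure Ω} {f : Ω → Ω}

theorem coeFn_iterate_compMeasurePreserving {E : Type*} [NormedAddCommGroup E] {p : ℝ≥0∞}
    (hf : MeasurePreserving f μ μ) {u : Ω → E} (hu : MemLp u p μ) (n : ℕ) :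
    ((Lp.compMeasurePreserving f hf)^[n] (hu.toLp u) : Ω → E) =ᵐ[μ] u ∘ f^[n] := by
  rw [Lp.compMeasurePreserving_iterate, Lp.toLp_compMeasurePreserving]
  exact MemLp.coeFn_toLp _

theorem coeFn_birkhoffAverage_compMeasurePreserving (𝕜 : Type*) {E : Type*} [RCLike 𝕜]
    [NormedAddCommGroup E] [NormedSpace 𝕜 E] {p : ℝ≥0∞} (hf : MeasurePreserving f μ μ)
    {u : Ω → E} (hu : MemLp u p μ) (N : ℕ) :
    ((birkhoffAverage 𝕜 (Lp.compMeasurePreserving f hf) id N (hu.toLp u) : Lp E p μ) : Ω → E) =ᵐ[μ]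
      birkhoffAverage 𝕜 f u N := by
  refine (Lp.coeFn_smul _ _).trans ?_
  filter_upwards [Lp.coeFn_fun_finsetSum (Finset.range N)
      fun n => (Lp.compMeasurePreserving f hf)^[n] (hu.toLp u),
    ae_all_iff.2 (coeFn_iterate_compMeasurePreserving hf hu)] with x hsum hiter
  simp only [Function.comp_apply] at hiter
  simp only [Pi.smul_apply, birkhoffSum, birkhoffAverage, id, hsum, hiter]

/-- The von Neumann mean ergodic theorem, in terms of functions. -/
theorem exists_tendsto_eLpNorm_birkhoffAverage (𝕜 : Type*) {E : Type*} [RCLike 𝕜]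
    [NormedAddCommGroup E] [InnerProductSpace 𝕜 E] [CompleteSpace E]
    (hf : MeasurePreserving f μ μ) {u : Ω → E} (hu : MemLp u 2 μ) :
    ∃ P : Ω → E, MemLp P 2 μ ∧ P ∘ f =ᵐ[μ] P ∧
      Tendsto (fun N => eLpNorm (birkhoffAverage 𝕜 f u N - P) 2 μ) atTop (𝓝 0) := by
  let U : Lp E 2 μ →L[𝕜] Lp E 2 μ := (Lp.compMeasurePreservingₗᵢ 𝕜 f hf).toContinuousLinearMap
  have hlim := U.tendsto_birkhoffAverage_orthogonalProjection
    (LinearIsometry.norm_toContinuousLinearMap_le _) (hu.toLp u)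
  let P := (U.eqLocus (1 : Lp E 2 μ →L[𝕜] Lp E 2 μ)).orthogonalProjectionOnto (hu.toLp u)
  have hP : Lp.compMeasurePreserving f hf (P : Lp E 2 μ) = P := P.2
  refine ⟨(P : Lp E 2 μ), Lp.memLp _, ?_, ?_⟩
  · simpa only [hP] using (Lp.coeFn_compMeasurePreserving (P : Lp E 2 μ) hf).symm
  · rw [Lp.tendsto_Lp_iff_tendsto_eLpNorm'] at hlim
    exact hlim.congr fun N => eLpNorm_congr_ae
      ((coeFn_birkhoffAverage_compMeasurePreserving 𝕜 hf hu N).sub EventuallyEq.rfl)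

theorem memLp_birkhoffAverage {𝕜 E : Type*} [RCLike 𝕜] [NormedAddCommGroup E] [NormedSpace 𝕜 E]
    (hf : MeasurePreserving f μ μ) {u : Ω → E} {p : ℝ≥0∞} (hu : MemLp u p μ) (N : ℕ) :
    MemLp (birkhoffAverage 𝕜 f u N) p μ :=
  (memLp_finsetSum (Finset.range N)
    fun n _ => hu.comp_measurePreserving (hf.iterate n)).const_smul (N : 𝕜)⁻¹

theorem exists_tendsto_eLpNorm_one_birkhoffAverage [IsProbabilityMeasure μ]
    (hf : MeasurePreserving f μ μ) {u : Ω → ℝ} (hu : MemLp u 2 μ) :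
    ∃ P : Ω → ℝ, Integrable P μ ∧ P ∘ f =ᵐ[μ] P ∧
      Tendsto (fun N => eLpNorm (birkhoffAverage ℝ f u N - P) 1 μ) atTop (𝓝 0) := by
  obtain ⟨P, hP, hPf, hlim⟩ := exists_tendsto_eLpNorm_birkhoffAverage ℝ hf hu
  refine ⟨P, hP.integrable one_le_two, hPf, ?_⟩
  exact tendsto_of_tendsto_of_tendsto_of_le_of_le tendsto_const_nhds hlim (fun _ => zero_le)
    fun N => eLpNorm_le_eLpNorm_of_exponent_le one_le_two
      ((memLp_birkhoffAverage hf hu N).sub hP).aestronglyMeasurable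

end MeanErgodic

section CesaroCorrelation

variable {Ω : Type*} [mΩ : MeasurableSpace Ω] {μ : Measure Ω} {f : Ω → Ω}

/-- The Cesàro mean `N⁻¹ ∑_{n < N} x n`, equal to `0` for `N = 0`. -/
noncomputable def cesaroMean (x : ℕ → ℝ) (N : ℕ) : ℝ :=
  (N : ℝ)⁻¹ * ∑ n ∈ Finset.range N, x n

/-- The Cesàro means of the correlations `μ (f⁻ⁿ A ∩ B)` of two sets, whose limits detect
ergodicity. -/
noncomputable def cesaroCorrelation (f : Ω → Ω) (μ : Measure Ω) (A B : Set Ω) : ℕ → ℝ :=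
  cesaroMean fun n => μ.real (f^[n] ⁻¹' A ∩ B)

theorem cesaroCorrelation_of_invariant (hf : MeasurePreserving f μ μ) {A D : Set Ω}
    (hA : MeasurableSet A) (hD : MeasurableSet D) (hfD : f ⁻¹' D = D) {N : ℕ} (hN : N ≠ 0) :
    cesaroCorrelation f μ A D N = μ.real (A ∩ D) := by
  have hn : ∀ n, μ.real (f^[n] ⁻¹' A ∩ D) = μ.real (A ∩ D) := fun n => by
    have hDn : f^[n] ⁻¹' D = D := Function.IsFixedPt.preimage_iterate hfD n
    conv_lhs => rw [← hDn, ← Set.preimage_inter]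
    exact (hf.iterate n).measureReal_preimage (hA.inter hD).nullMeasurableSet
  simp [cesaroCorrelation, cesaroMean, hn, hN]

theorem measureReal_inter_eq_of_tendsto_cesaroCorrelation (hf : MeasurePreserving f μ μ)
    {A D : Set Ω} (hA : MeasurableSet A) (hD : MeasurableSet D) (hfD : f ⁻¹' D = D) {c : ℝ}
    (h : Tendsto (cesaroCorrelation f μ A D) atTop (𝓝 c)) : μ.real (A ∩ D) = c :=
  tendsto_nhds_unique (tendsto_const_nhds.congr' <| (eventually_ne_atTop 0).mono fun _ hN =>
    (cesaroCorrelation_of_invariant hf hA hD hfD hN).symm) h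

variable [IsProbabilityMeasure μ]

theorem memLp_indicator_one {A : Set Ω} (hA : MeasurableSet A) (p : ℝ≥0∞) :
    MemLp (A.indicator (1 : Ω → ℝ)) p μ :=
  memLp_indicator_const p hA 1 (Or.inr (measure_ne_top _ _))

theorem setIntegral_birkhoffAverage_indicator (hf : Measurable f) {A : Set Ω}
    (hA : MeasurableSet A) (B : Set Ω) (N : ℕ) :
    ∫ x in B, birkhoffAverage ℝ f (A.indicator 1) N x ∂μ = cesaroCorrelation f μ A B N := by
  have hAn : ∀ n, MeasurableSet (f^[n] ⁻¹' A) := fun n => hf.iterate n hA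
  have hind : ∀ n x, A.indicator (1 : Ω → ℝ) (f^[n] x) = (f^[n] ⁻¹' A).indicator 1 x :=
    fun _ _ => rfl
  simp only [birkhoffAverage, birkhoffSum, smul_eq_mul, cesaroCorrelation, cesaroMean,
    hind]
  rw [integral_const_mul, integral_finsetSum _ fun n _ =>
    ((memLp_indicator_one (hAn n) 1).integrable le_rfl).integrableOn]
  simp only [integral_indicator_one (hAn _), measureReal_restrict_apply (hAn _)]

theorem exists_tendsto_cesaroCorrelation (hf : MeasurePreserving f μ μ) {A : Set Ω}
    (hA : MeasurableSet A) :
    ∃ P : Ω → ℝ, Integrable P μ ∧ P ∘ f =ᵐ[μ] P ∧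
      ∀ B, Tendsto (cesaroCorrelation f μ A B) atTop (𝓝 (∫ x in B, P x ∂μ)) := by
  have hu := memLp_indicator_one (μ := μ) hA 2
  obtain ⟨P, hP, hPf, hlim⟩ := exists_tendsto_eLpNorm_one_birkhoffAverage hf hu
  refine ⟨P, hP, hPf, fun B => ?_⟩
  simpa only [setIntegral_birkhoffAverage_indicator hf.measurable hA] using
    tendsto_setIntegral_of_L1' P hP.aestronglyMeasurable
      (Eventually.of_forall fun N => (memLp_birkhoffAverage hf hu N).integrable one_le_two) hlim B

/-- A set `D` independent of a generating π-system is independent of itself. -/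
theorem ergodic_of_forall_measureReal_inter_eq_mul (hf : MeasurePreserving f μ μ)
    {C : Set (Set Ω)} (hgen : mΩ = MeasurableSpace.generateFrom C) (hpi : IsPiSystem C)
    (h : ∀ A ∈ C, ∃ c : ℝ, ∀ D, MeasurableSet D → f ⁻¹' D = D → μ.real (A ∩ D) = c * μ.real D) :
    Ergodic f μ := by
  refine ⟨hf, ⟨fun D hD hfD => ?_⟩⟩
  have hindep : μ.restrict D = μ D • μ := by
    refine ext_of_generate_finite C hgen hpi (fun A hA => ?_) (by simp)
    obtain ⟨c, hc⟩ := h A hA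
    have hcA : μ.real A = c := by simpa using hc Set.univ MeasurableSet.univ rfl
    have hAm : MeasurableSet A := hgen ▸ MeasurableSpace.measurableSet_generateFrom hA
    rw [← measureReal_eq_measureReal_iff (h₂ := ENNReal.mul_ne_top (by simp) (by simp)),
      measureReal_restrict_apply hAm, hc D hD hfD, measureReal_ennreal_smul_apply, hcA,
      mul_comm, Measure.real]
  have hD_or : μ D = 0 ∨ μ Dᶜ = 0 := by
    simpa [Measure.restrict_apply hD.compl, eq_comm] using
      congrArg (fun m : Measure Ω => m Dᶜ) hindep
  exact eventuallyConst_set'.2 (hD_or.imp ae_eq_empty.2 ae_eq_univ.2)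

theorem setIntegral_eq_mul_of_generateFrom {P : Ω → ℝ} (hP : Integrable P μ) {c : ℝ}
    {C : Set (Set Ω)} (hgen : mΩ = MeasurableSpace.generateFrom C) (hpi : IsPiSystem C)
    (huniv : ∫ x, P x ∂μ = c) (h : ∀ B ∈ C, ∫ x in B, P x ∂μ = c * μ.real B)
    {B : Set Ω} (hB : MeasurableSet B) : ∫ x in B, P x ∂μ = c * μ.real B := by
  induction B, hB using MeasurableSpace.induction_on_inter hgen hpi with
  | empty => simp
  | basic B hB => exact h B hB
  | compl B hB ih => rw [setIntegral_compl hB hP, ih, huniv, probReal_compl_eq_one_sub hB]; ring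
  | iUnion g hd hg ih =>
    have hsum := hasSum_integral_iUnion hg hd hP.integrableOn
    simp only [ih] at hsum
    have hreal : HasSum (fun i => μ.real (g i)) (μ.real (⋃ i, g i)) := by
      simpa using hasSum_integral_iUnion (f := fun _ => (1 : ℝ)) hg hd
        (integrable_const (μ := μ) (1 : ℝ)).integrableOn
    exact hsum.unique (hreal.mul_left _)

theorem ergodic_of_tendsto_cesaroCorrelation (hf : MeasurePreserving f μ μ)
    {C : Set (Set Ω)} (hgen : mΩ = MeasurableSpace.generateFrom C) (hpi : IsPiSystem C)
    (h : ∀ A ∈ C, ∀ B ∈ C,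
      Tendsto (cesaroCorrelation f μ A B) atTop (𝓝 (μ.real A * μ.real B))) :
    Ergodic f μ := by
  refine ergodic_of_forall_measureReal_inter_eq_mul hf hgen hpi fun A hA =>
    ⟨μ.real A, fun D hD hfD => ?_⟩
  have hAm : MeasurableSet A := hgen ▸ MeasurableSpace.measurableSet_generateFrom hA
  obtain ⟨P, hP, -, hlim⟩ := exists_tendsto_cesaroCorrelation hf hAm
  have hinv : ∀ D, MeasurableSet D → f ⁻¹' D = D → μ.real (A ∩ D) = ∫ x in D, P x ∂μ :=
    fun D hD hfD => measureReal_inter_eq_of_tendsto_cesaroCorrelation hf hAm hD hfD (hlim D)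
  rw [hinv D hD hfD]
  refine setIntegral_eq_mul_of_generateFrom hP hgen hpi ?_
    (fun B hB => tendsto_nhds_unique (hlim B) (h A hA B hB)) hD
  simpa using (hinv Set.univ MeasurableSet.univ rfl).symm

theorem tendsto_cesaroCorrelation_of_ergodic (hf : Ergodic f μ) {A : Set Ω}
    (hA : MeasurableSet A) (B : Set Ω) :
    Tendsto (cesaroCorrelation f μ A B) atTop (𝓝 (μ.real A * μ.real B)) := by
  obtain ⟨P, hP, hPf, hlim⟩ := exists_tendsto_cesaroCorrelation hf.toMeasurePreserving hA
  obtain ⟨c, hc⟩ := hf.ae_eq_const_of_ae_eq_comp_ae hP.aestronglyMeasurable hPf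
  have hint : ∀ B, ∫ x in B, P x ∂μ = c * μ.real B := fun B => by
    rw [integral_congr_ae (ae_restrict_of_ae hc)]
    simp [mul_comm]
  have hcA : μ.real A = c := by
    simpa only [hint, Set.inter_univ, probReal_univ, mul_one] using
      measureReal_inter_eq_of_tendsto_cesaroCorrelation hf.toMeasurePreserving hA
        MeasurableSet.univ rfl (hlim Set.univ)
  simpa only [hint, ← hcA] using hlim B

end CesaroCorrelation

section WeakMixing

theorem tendsto_cesaroMean_sq_sub {x : ℕ → ℝ} {a : ℝ}
    (hx : Tendsto (cesaroMean x) atTop (𝓝 a))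
    (hx2 : Tendsto (cesaroMean fun n => x n ^ 2) atTop (𝓝 (a ^ 2))) :
    Tendsto (cesaroMean fun n => (x n - a) ^ 2) atTop (𝓝 0) := by
  have hlim := (hx2.sub (hx.const_mul (2 * a))).add_const (a ^ 2)
  rw [show a ^ 2 - 2 * a * a + a ^ 2 = 0 by ring] at hlim
  refine hlim.congr' ((eventually_ne_atTop 0).mono fun N hN => ?_)
  have hexpand : ∑ n ∈ Finset.range N, (x n - a) ^ 2 =
      ∑ n ∈ Finset.range N, x n ^ 2 - 2 * a * ∑ n ∈ Finset.range N, x n + N * a ^ 2 := by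
    simp only [sub_sq, Finset.sum_add_distrib, Finset.sum_sub_distrib, Finset.mul_sum,
      Finset.sum_const, Finset.card_range, nsmul_eq_mul, mul_right_comm _ _ a]
  simp only [cesaroMean, hexpand]
  field_simp

theorem tendsto_cesaroMean_abs_sub {x : ℕ → ℝ} {a : ℝ}
    (hx : Tendsto (cesaroMean x) atTop (𝓝 a))
    (hx2 : Tendsto (cesaroMean fun n => x n ^ 2) atTop (𝓝 (a ^ 2))) :
    Tendsto (cesaroMean fun n => |x n - a|) atTop (𝓝 0) := by
  have hsqrt := (tendsto_cesaroMean_sq_sub hx hx2).sqrt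
  rw [Real.sqrt_zero] at hsqrt
  refine squeeze_zero (fun N => by unfold cesaroMean; positivity)
    (fun N => Real.le_sqrt_of_sq_le ?_) hsqrt
  simpa only [cesaroMean, div_eq_inv_mul, Finset.card_range, sq_abs] using
    sum_div_card_sq_le_sum_sq_div_card (s := Finset.range N) (f := fun n => |x n - a|)

theorem abs_prod_sub_prod_le {ι : Type*} (s : Finset ι) {x y : ι → ℝ}
    (hx : ∀ i, x i ∈ Set.Icc (0 : ℝ) 1) (hy : ∀ i, y i ∈ Set.Icc (0 : ℝ) 1) :
    |∏ i ∈ s, x i - ∏ i ∈ s, y i| ≤ ∑ i ∈ s, |x i - y i| := by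
  classical
  induction s using Finset.induction_on with
  | empty => simp
  | insert i s hi ih =>
    rw [Finset.prod_insert hi, Finset.prod_insert hi, Finset.sum_insert hi]
    have hxs : |∏ j ∈ s, x j| ≤ 1 := by
      rw [Finset.abs_prod]
      exact Finset.prod_le_one (fun _ _ => abs_nonneg _)
        fun j _ => (abs_of_nonneg (hx j).1).trans_le (hx j).2
    have hyi : |y i| ≤ 1 := (abs_of_nonneg (hy i).1).trans_le (hy i).2
    calc |x i * ∏ j ∈ s, x j - y i * ∏ j ∈ s, y j|
        = |(x i - y i) * ∏ j ∈ s, x j + y i * (∏ j ∈ s, x j - ∏ j ∈ s, y j)| := by ring_nf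
      _ ≤ |x i - y i| * |∏ j ∈ s, x j| + |y i| * |∏ j ∈ s, x j - ∏ j ∈ s, y j| := by
          rw [← abs_mul, ← abs_mul]; exact abs_add_le _ _
      _ ≤ |x i - y i| * 1 + 1 * ∑ j ∈ s, |x j - y j| := by gcongr
      _ = |x i - y i| + ∑ j ∈ s, |x j - y j| := by ring

theorem tendsto_cesaroMean_prod {ι : Type*} [Fintype ι] {x : ι → ℕ → ℝ} {a : ι → ℝ}
    (hx : ∀ i n, x i n ∈ Set.Icc (0 : ℝ) 1) (ha : ∀ i, a i ∈ Set.Icc (0 : ℝ) 1)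
    (h : ∀ i, Tendsto (cesaroMean fun n => |x i n - a i|) atTop (𝓝 0)) :
    Tendsto (cesaroMean fun n => ∏ i, x i n) atTop (𝓝 (∏ i, a i)) := by
  have hsum := tendsto_finsetSum Finset.univ fun i _ => h i
  rw [Finset.sum_const_zero] at hsum
  refine tendsto_iff_dist_tendsto_zero.2 <|
    squeeze_zero' (Eventually.of_forall fun _ => dist_nonneg) ?_ hsum
  filter_upwards [eventually_ne_atTop 0] with N hN
  have hconst : ∏ i, a i = (N : ℝ)⁻¹ * ∑ _n ∈ Finset.range N, ∏ i, a i := by simp [hN]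
  simp only [cesaroMean]
  rw [Real.dist_eq, hconst, ← mul_sub, ← Finset.sum_sub_distrib, abs_mul,
    abs_of_nonneg (by positivity), ← Finset.mul_sum, Finset.sum_comm]
  gcongr
  exact (Finset.abs_sum_le_sum_abs _ _).trans
    (Finset.sum_le_sum fun n _ => abs_prod_sub_prod_le _ (fun i => hx i n) ha)

variable {Y : Type*} [MeasurableSpace Y] {S : Y ≃ᵐ Y} {ν : Measure Y} [IsProbabilityMeasure ν]

theorem IsWeaklyMixing.ergodic (h : IsWeaklyMixing S ν) : Ergodic S ν :=
  measurePreserving_fst.ergodic_of_ergodic_semiconj h.ergodic_prod S.measurable fun _ => rfl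

/-- Ergodicity of `S × S` says that the squares of the correlations converge in Cesàro mean to the
square of the limit of the correlations, so that the correlations have vanishing variance. -/
theorem IsWeaklyMixing.tendsto_cesaroMean_abs_sub (h : IsWeaklyMixing S ν) {A : Set Y}
    (hA : MeasurableSet A) (B : Set Y) :
    Tendsto (cesaroMean fun n => |ν.real (S^[n] ⁻¹' A ∩ B) - ν.real A * ν.real B|) atTop (𝓝 0) := by
  have hsq : ∀ C : Set Y, (ν.prod ν).real (C ×ˢ C) = ν.real C ^ 2 := fun C => by
    rw [measureReal_prod_prod, sq]
  have hpre : ∀ n, (Prod.map S S)^[n] ⁻¹' (A ×ˢ A) ∩ B ×ˢ B =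
      (S^[n] ⁻¹' A ∩ B) ×ˢ (S^[n] ⁻¹' A ∩ B) := fun n => by
    rw [Prod.map_iterate, Set.preimage_prod_map_prod, Set.prod_inter_prod]
  have hlim2 := tendsto_cesaroCorrelation_of_ergodic h.ergodic_prod (hA.prod hA) (B ×ˢ B)
  simp only [cesaroCorrelation, hpre, hsq, ← mul_pow] at hlim2
  exact JoiningPrimeness.tendsto_cesaroMean_abs_sub
    (tendsto_cesaroCorrelation_of_ergodic h.ergodic hA B) hlim2

theorem ergodic_pi_of_isWeaklyMixing {ι : Type*} [Fintype ι] {Y : ι → Type*}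
    [∀ i, MeasurableSpace (Y i)] {ν : ∀ i, Measure (Y i)} [∀ i, IsProbabilityMeasure (ν i)]
    {S : ∀ i, Y i ≃ᵐ Y i} (h : ∀ i, IsWeaklyMixing (S i) (ν i)) :
    Ergodic (Pi.map fun i => S i) (Measure.pi ν) := by
  refine ergodic_of_tendsto_cesaroCorrelation
    (measurePreserving_pi ν ν fun i => (h i).measurePreserving) generateFrom_pi.symm
    isPiSystem_pi ?_
  rintro _ ⟨A, hA, rfl⟩ _ ⟨B, -, rfl⟩
  have hpi : ∀ t : ∀ i, Set (Y i), (Measure.pi ν).real (Set.univ.pi t) = ∏ i, (ν i).real (t i) :=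
    fun t => by simp only [Measure.real, Measure.pi_pi, ENNReal.toReal_prod]
  have hpre : ∀ n, (Pi.map fun i => S i)^[n] ⁻¹' (Set.univ.pi A) ∩ Set.univ.pi B =
      Set.univ.pi fun i => (S i)^[n] ⁻¹' A i ∩ B i := fun n => by
    rw [Pi.map_iterate, Set.pi_inter_distrib]; rfl
  simp only [cesaroCorrelation, hpre, hpi, ← Finset.prod_mul_distrib]
  exact tendsto_cesaroMean_prod (fun i n => ⟨measureReal_nonneg, measureReal_le_one⟩)
    (fun i => ⟨by positivity, mul_le_one₀ measureReal_le_one measureReal_nonneg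
      measureReal_le_one⟩)
    fun i => (h i).tendsto_cesaroMean_abs_sub (hA i (Set.mem_univ i)) (B i)

end WeakMixing

section CondExpKernel

theorem measurable_diag_of_le {Ω : Type*} {m mΩ : MeasurableSpace Ω} (hm : m ≤ mΩ) :
    @Measurable Ω (Ω × Ω) mΩ (m.prod mΩ) Function.diag :=
  @Measurable.prodMk _ mΩ _ _ m mΩ _ _ (measurable_id'' hm) measurable_id

variable {Ω : Type*} {m : MeasurableSpace Ω} [mΩ : MeasurableSpace Ω] [StandardBorelSpace Ω]
  {μ : Measure Ω} [IsFiniteMeasure μ]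

theorem ae_ae_condExpKernel (hm : m ≤ mΩ) {p : Ω → Prop} (hp : ∀ᵐ x ∂μ, p x) :
    ∀ᵐ ω ∂μ, ∀ᵐ x ∂condExpKernel μ m ω, p x := by
  rw [← condExpKernel_comp_trim (μ := μ) hm] at hp
  exact ae_of_ae_trim hm (Measure.ae_ae_of_ae_comp hp)

theorem ae_ae_condExpKernel_eq (hm : m ≤ mΩ) {g : Ω → ℝ} (hg : Measurable[m] g) :
    ∀ᵐ ω ∂μ, ∀ᵐ x ∂condExpKernel μ m ω, g x = g ω := by
  refine ae_of_ae_trim hm (Measure.ae_ae_of_ae_compProd (p := fun q => g q.2 = g q.1) ?_)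
  rw [compProd_trim_condExpKernel hm]
  have hset : MeasurableSet[m.prod mΩ] {q : Ω × Ω | g q.2 = g q.1} :=
    @measurableSet_eq_fun _ _ (m.prod mΩ) _ _ _ _
      ((hg.mono hm le_rfl).comp (@measurable_snd _ _ m mΩ))
      (hg.comp (@measurable_fst _ _ m mΩ))
  exact (@ae_map_iff _ _ mΩ (m.prod mΩ) _ _
    (@Measurable.aemeasurable _ _ mΩ (m.prod mΩ) _ _ (measurable_diag_of_le hm)) _ hset).2
    (ae_of_all _ fun _ => rfl)

theorem setLIntegral_condExpKernel_trim (hm : m ≤ mΩ) {A D : Set Ω} (hA : MeasurableSet A)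
    (hD : MeasurableSet[m] D) :
    ∫⁻ ω in D, condExpKernel μ m ω A ∂μ.trim hm = μ (D ∩ A) := by
  rw [← @Measure.compProd_apply_prod _ _ m mΩ _ _ _ _ _ _ hD hA,
    compProd_trim_condExpKernel hm,
    @Measure.map_apply _ _ mΩ (m.prod mΩ) _ _ (measurable_diag_of_le hm) _
      (@MeasurableSet.prod _ _ m mΩ _ _ hD hA)]
  rfl

theorem ae_map_condExpKernel_eq {W : Type*} [MeasurableSpace W]
    [MeasurableSpace.CountablyGenerated W] (hm : m ≤ mΩ) {p : Ω → W} (hp : Measurable p)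
    (κ : Kernel[m] Ω W) [IsFiniteKernel κ]
    (h : ∀ D, MeasurableSet[m] D → ∀ A, MeasurableSet A →
      ∫⁻ ω in D, κ ω A ∂μ.trim hm = μ (D ∩ p ⁻¹' A)) :
    ∀ᵐ ω ∂μ, (condExpKernel μ m ω).map p = κ ω := by
  have hcompProd : (μ.trim hm) ⊗ₘ (condExpKernel μ m).map p = (μ.trim hm) ⊗ₘ κ := by
    refine Measure.ext_prod fun {D A} hD hA => ?_
    rw [Measure.compProd_apply_prod hD hA, Measure.compProd_apply_prod hD hA, h D hD A hA,
      ← setLIntegral_condExpKernel_trim hm (hp hA) hD]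
    simp only [Kernel.map_apply' _ hp _ hA]
  filter_upwards [ae_of_ae_trim hm (Kernel.ae_eq_of_compProd_eq hcompProd)] with ω hω
  rwa [Kernel.map_apply _ hp] at hω

theorem integral_condExpKernel_real (hm : m ≤ mΩ) {A : Set Ω} (hA : MeasurableSet A) :
    ∫ ω, (condExpKernel μ m ω).real A ∂μ = μ.real A := by
  rw [integral_congr_ae (condExpKernel_ae_eq_condExp hm hA), integral_condExp hm,
    integral_indicator hA]
  simp

end CondExpKernel

section ErgodicDecomposition

theorem exists_countable_isPiSystem_generateFrom (Ω : Type*) [mΩ : MeasurableSpace Ω]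
    [MeasurableSpace.CountablyGenerated Ω] :
    ∃ C : Set (Set Ω), C.Countable ∧ IsPiSystem C ∧ mΩ = MeasurableSpace.generateFrom C := by
  refine ⟨generateSetAlgebra (MeasurableSpace.countableGeneratingSet Ω),
    countable_generateSetAlgebra MeasurableSpace.countable_countableGeneratingSet,
    fun s hs t ht _ => isSetAlgebra_generateSetAlgebra.inter_mem hs ht, ?_⟩
  rw [generateFrom_generateSetAlgebra_eq, MeasurableSpace.generateFrom_countableGeneratingSet]

section BirkhoffAverage

theorem norm_birkhoffAverage_le {Ω E : Type*} [NormedAddCommGroup E] [NormedSpace ℝ E]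
    (f : Ω → Ω) {u : Ω → E} {b : ℝ} (hb : 0 ≤ b) (hu : ∀ x, ‖u x‖ ≤ b) (N : ℕ) (x : Ω) :
    ‖birkhoffAverage ℝ f u N x‖ ≤ b := by
  have hsum : ‖birkhoffSum f u N x‖ ≤ N * b := by
    simpa [birkhoffSum] using norm_sum_le_of_le (Finset.range N) fun n _ => hu (f^[n] x)
  rw [birkhoffAverage, norm_smul, norm_inv, RCLike.norm_natCast]
  exact inv_mul_le_of_le_mul₀ (by positivity) hb hsum

theorem norm_indicator_one_le {Ω : Type*} (A : Set Ω) (x : Ω) :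
    ‖A.indicator (1 : Ω → ℝ) x‖ ≤ 1 := by
  simpa using norm_indicator_le_norm_self (s := A) (1 : Ω → ℝ) x

variable {Ω : Type*} [MeasurableSpace Ω] {μ : Measure Ω} [IsProbabilityMeasure μ] {f : Ω → Ω}

theorem measurable_birkhoffAverage (hf : Measurable f) {u : Ω → ℝ} (hu : Measurable u) (N : ℕ) :
    Measurable (birkhoffAverage ℝ f u N) :=
  (Finset.measurable_fun_sum _ fun n _ => hu.comp (hf.iterate n)).const_smul (N : ℝ)⁻¹

/-- The limit is defined by `limUnder` along the subsequence, which makes it invariant everywhere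
and not only almost everywhere. -/
theorem exists_tendsto_birkhoffAverage_invariants (hf : MeasurePreserving f μ μ) {u : Ω → ℝ}
    (hu : Measurable u) {b : ℝ} (hub : ∀ x, ‖u x‖ ≤ b) :
    ∃ (ns : ℕ → ℕ) (g : Ω → ℝ), StrictMono ns ∧ Measurable[MeasurableSpace.invariants f] g ∧
      ∀ᵐ x ∂μ, Tendsto (fun i => birkhoffAverage ℝ f u (ns i) x) atTop (𝓝 (g x)) := by
  have hu2 : MemLp u 2 μ := MemLp.of_bound hu.aestronglyMeasurable b (ae_of_all _ hub)
  have hbdd : Bornology.IsBounded (Set.range u) :=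
    isBounded_iff_forall_norm_le.2 ⟨b, Set.forall_mem_range.2 hub⟩
  obtain ⟨P, hP, -, hlim⟩ := exists_tendsto_eLpNorm_one_birkhoffAverage hf hu2
  obtain ⟨ns, hns, hae⟩ := (tendstoInMeasure_of_tendsto_eLpNorm one_ne_zero
    (fun N => (memLp_birkhoffAverage hf hu2 N).aestronglyMeasurable) hP.aestronglyMeasurable
    hlim).exists_seq_tendsto_ae
  refine ⟨ns, fun x => limUnder atTop fun i => birkhoffAverage ℝ f u (ns i) x, hns, ?_, ?_⟩
  · refine MeasurableSpace.measurable_invariants_dom.2 ⟨(StronglyMeasurable.limUnder fun i =>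
      (measurable_birkhoffAverage hf.measurable hu (ns i)).stronglyMeasurable).measurable,
      fun s _ => congrArg (· ⁻¹' s) (funext fun x => congrArg Classical.epsilon ?_)⟩
    funext c
    refine propext (tendsto_iff_of_dist ?_)
    simpa only [dist_eq_norm, norm_zero, Function.comp_apply] using
      ((tendsto_birkhoffAverage_apply_sub_birkhoffAverage' ℝ hbdd f x).comp hns.tendsto_atTop).norm
  · filter_upwards [hae] with x hx
    exact tendsto_nhds_limUnder ⟨P x, hx⟩

theorem measureReal_inter_eq_of_ae_tendsto_birkhoffAverage (hf : MeasurePreserving f μ μ)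
    {A : Set Ω} (hA : MeasurableSet A) {ns : ℕ → ℕ} (hns : StrictMono ns) {c : ℝ}
    (hlim : ∀ᵐ x ∂μ, Tendsto (fun i => birkhoffAverage ℝ f (A.indicator 1) (ns i) x) atTop (𝓝 c))
    {D : Set Ω} (hD : MeasurableSet D) (hfD : f ⁻¹' D = D) : μ.real (A ∩ D) = c * μ.real D := by
  have hconv : Tendsto (fun i => ∫ x in D, birkhoffAverage ℝ f (A.indicator 1) (ns i) x ∂μ) atTop
      (𝓝 (∫ _ in D, c ∂μ)) :=
    tendsto_integral_of_dominated_convergence (fun _ => 1)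
      (fun i => (measurable_birkhoffAverage hf.measurable
        (measurable_one.indicator hA) (ns i)).aestronglyMeasurable)
      (integrable_const 1) (fun i => ae_of_all _ fun x =>
        norm_birkhoffAverage_le f zero_le_one (norm_indicator_one_le A) (ns i) x)
      (ae_restrict_of_ae hlim)
  rw [setIntegral_const, smul_eq_mul, mul_comm] at hconv
  refine tendsto_nhds_unique (tendsto_const_nhds.congr' ?_) hconv
  filter_upwards [hns.tendsto_atTop.eventually_ne_atTop 0] with i hi
  rw [setIntegral_birkhoffAverage_indicator hf.measurable hA,
    cesaroCorrelation_of_invariant hf hA hD hfD hi]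

end BirkhoffAverage

variable {Ω : Type*} [mΩ : MeasurableSpace Ω] [StandardBorelSpace Ω] {μ : Measure Ω}
  [IsProbabilityMeasure μ] {f : Ω → Ω}

theorem ae_measurePreserving_condExpKernel_invariants (hf : MeasurePreserving f μ μ) :
    ∀ᵐ ω ∂μ, MeasurePreserving f (condExpKernel μ (MeasurableSpace.invariants f) ω)
      (condExpKernel μ (MeasurableSpace.invariants f) ω) := by
  have hm := MeasurableSpace.invariants_le f
  have hmap := ae_map_condExpKernel_eq hm hf.measurable
    (condExpKernel μ (MeasurableSpace.invariants f)) fun D hD A hA => by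
      have hinv := hf.measure_preimage (hD.1.inter hA).nullMeasurableSet
      rw [Set.preimage_inter, hD.2] at hinv
      rw [setLIntegral_condExpKernel_trim hm hA hD, hinv]
  filter_upwards [hmap] with ω hω using ⟨hf.measurable, hω⟩

/-- A function measurable for the σ-algebra of invariant sets is constant on almost every
component, so almost every component sees constant limits of Birkhoff averages. -/
theorem ae_ergodic_condExpKernel_invariants (hf : MeasurePreserving f μ μ) :
    ∀ᵐ ω ∂μ, Ergodic f (condExpKernel μ (MeasurableSpace.invariants f) ω) := by
  obtain ⟨C, hCc, hCpi, hCgen⟩ := exists_countable_isPiSystem_generateFrom Ω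
  have hm : MeasurableSpace.invariants f ≤ mΩ := MeasurableSpace.invariants_le f
  have hCm : ∀ A ∈ C, MeasurableSet A := fun A hA =>
    hCgen ▸ MeasurableSpace.measurableSet_generateFrom hA
  have hlim : ∀ᵐ ω ∂μ, ∀ A ∈ C, ∃ (ns : ℕ → ℕ) (c : ℝ), StrictMono ns ∧
      ∀ᵐ x ∂condExpKernel μ (MeasurableSpace.invariants f) ω,
        Tendsto (fun i => birkhoffAverage ℝ f (A.indicator 1) (ns i) x) atTop (𝓝 c) := by
    refine (ae_ball_iff hCc).2 fun A hA => ?_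
    obtain ⟨ns, g, hns, hg, hae⟩ := exists_tendsto_birkhoffAverage_invariants hf
      (measurable_one.indicator (hCm A hA)) (norm_indicator_one_le A)
    filter_upwards [ae_ae_condExpKernel hm hae, ae_ae_condExpKernel_eq hm hg] with ω hω hgω
    refine ⟨ns, g ω, hns, ?_⟩
    filter_upwards [hω, hgω] with x hx hgx
    rwa [← hgx]
  filter_upwards [ae_measurePreserving_condExpKernel_invariants hf, hlim] with ω hω hlimω
  refine ergodic_of_forall_measureReal_inter_eq_mul hω hCgen hCpi fun A hA => ?_
  obtain ⟨ns, c, hns, hc⟩ := hlimω A hA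
  exact ⟨c, fun D hD hfD =>
    measureReal_inter_eq_of_ae_tendsto_birkhoffAverage hω (hCm A hA) hns hc hD hfD⟩

end ErgodicDecomposition

section ErgodicFactor

/-- The image under `p` of the restriction of `μ` to an invariant set is an invariant measure
absolutely continuous with respect to an ergodic one, hence a multiple of it. -/
theorem measure_inter_preimage_of_ergodic {Ω W : Type*} [MeasurableSpace Ω] [MeasurableSpace W]
    {μ : Measure Ω} [IsFiniteMeasure μ] {η : Measure W} [IsProbabilityMeasure η]
    {f : Ω → Ω} {g : W → W} (hf : MeasurePreserving f μ μ) (hg : Ergodic g η) {p : Ω → W}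
    (hp : MeasurePreserving p μ η) (hpf : p ∘ f = g ∘ p) {D : Set Ω} (hD : MeasurableSet D)
    (hfD : f ⁻¹' D = D) {A : Set W} (hA : MeasurableSet A) : μ (D ∩ p ⁻¹' A) = η A * μ D := by
  have hinv : MeasurePreserving g ((μ.restrict D).map p) ((μ.restrict D).map p) := by
    refine ⟨hg.measurable, ?_⟩
    have hfD' := (hf.restrict_preimage hD).map_eq
    rw [hfD] at hfD'
    rw [Measure.map_map hg.measurable hp.measurable, ← hpf,
      ← Measure.map_map hp.measurable hf.measurable, hfD']
  have hac : (μ.restrict D).map p ≪ η :=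
    hp.map_eq ▸ (Measure.absolutelyContinuous_of_le Measure.restrict_le_self).map hp.measurable
  obtain ⟨c, hc⟩ := hg.eq_smul_of_absolutelyContinuous hinv hac
  have happly : ∀ B, MeasurableSet B → μ (D ∩ p ⁻¹' B) = c * η B := fun B hB => by
    simpa [Measure.map_apply hp.measurable hB, Measure.restrict_apply (hp.measurable hB),
      Set.inter_comm] using congrArg (fun τ : Measure W => τ B) hc
  have hcD : μ D = c := by simpa using happly Set.univ MeasurableSet.univ
  rw [happly A hA, hcD, mul_comm]

theorem ae_map_condExpKernel_invariants_eq {Ω W : Type*} [MeasurableSpace Ω]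
    [StandardBorelSpace Ω] [MeasurableSpace W] [MeasurableSpace.CountablyGenerated W]
    {μ : Measure Ω} [IsFiniteMeasure μ] {η : Measure W} [IsProbabilityMeasure η] {f : Ω → Ω}
    {g : W → W} (hf : MeasurePreserving f μ μ) (hg : Ergodic g η) {p : Ω → W}
    (hp : MeasurePreserving p μ η) (hpf : p ∘ f = g ∘ p) :
    ∀ᵐ ω ∂μ, (condExpKernel μ (MeasurableSpace.invariants f) ω).map p = η := by
  have hm := MeasurableSpace.invariants_le f
  refine ae_map_condExpKernel_eq hm hp.measurable
    (@Kernel.const _ _ (MeasurableSpace.invariants f) _ η) fun D hD A hA => ?_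
  simp only [Kernel.const_apply, setLIntegral_const, trim_measurableSet_eq hm hD]
  exact (measure_inter_preimage_of_ergodic hf hg hp hpf hD.1 hD.2 hA).symm

theorem IsJoining.ae_ergodic_condExpKernel_invariants {Z W : Type*} [MeasurableSpace Z]
    [MeasurableSpace W] [StandardBorelSpace Z] [StandardBorelSpace W] {ρ : Measure Z}
    [IsProbabilityMeasure ρ] {η : Measure W} [IsProbabilityMeasure η] {R : Z → Z} {S : W → W}
    {l : Measure (Z × W)} [IsProbabilityMeasure l] (hl : IsJoining R ρ S η l)
    (hR : Ergodic R ρ) (hS : Ergodic S η) :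
    ∀ᵐ ω ∂l,
      IsJoining R ρ S η (condExpKernel l (MeasurableSpace.invariants (Prod.map R S)) ω) ∧
      Ergodic (Prod.map R S) (condExpKernel l (MeasurableSpace.invariants (Prod.map R S)) ω) := by
  filter_upwards [
    JoiningPrimeness.ae_ergodic_condExpKernel_invariants hl.invariant,
    ae_map_condExpKernel_invariants_eq hl.invariant hR ⟨measurable_fst, hl.map_fst⟩ rfl,
    ae_map_condExpKernel_invariants_eq hl.invariant hS ⟨measurable_snd, hl.map_snd⟩ rfl]
    with ω herg hfst hsnd
  exact ⟨⟨hfst, hsnd, herg.toMeasurePreserving⟩, herg⟩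

theorem abs_measureReal_sub_le_of_ae_condExpKernel {Ω : Type*} {m : MeasurableSpace Ω}
    [mΩ : MeasurableSpace Ω] [StandardBorelSpace Ω] {μ : Measure Ω} [IsProbabilityMeasure μ]
    (hm : m ≤ mΩ) {E : Set Ω} (hE : MeasurableSet E) {c δ : ℝ}
    (h : ∀ᵐ ω ∂μ, |(condExpKernel μ m ω).real E - c| ≤ δ) : |μ.real E - c| ≤ δ := by
  rw [← integral_condExpKernel_real hm hE]
  exact (convex_closedBall c δ).integral_mem Metric.isClosed_closedBall h
    (integrable_toReal_condExpKernel hE)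

end ErgodicFactor

section RelativelyIndependentExtension

theorem IsJoining.isProbabilityMeasure {X Z : Type*} [MeasurableSpace X] [MeasurableSpace Z]
    {μ : Measure X} [IsProbabilityMeasure μ] {ρ : Measure Z} {T : X → X} {R : Z → Z}
    {κ : Measure (X × Z)} (hκ : IsJoining T μ R ρ κ) : IsProbabilityMeasure κ := by
  have : IsProbabilityMeasure (κ.map Prod.fst) := by rw [hκ.map_fst]; infer_instance
  exact Measure.isProbabilityMeasure_of_map Prod.fst

variable {X Z W : Type*} [MeasurableSpace X] [MeasurableSpace Z] [MeasurableSpace W]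
  [StandardBorelSpace Z] [Nonempty Z] {μ : Measure X} {ρ : Measure Z} {ν : Measure W}
  {κ : Measure (X × Z)} [IsFiniteMeasure κ] {π : W → X}

/-- The relatively independent extension of a measure `κ` on `X × Z` along a factor map
`π : W → X`: the law of `(z, w)` when `w` is drawn from `ν` and `z` from the disintegration of `κ`
over the point `π w`. -/
noncomputable def relIndepExtension (κ : Measure (X × Z)) [IsFiniteMeasure κ] (ν : Measure W)
    (π : W → X) (hπ : Measurable π) : Measure (Z × W) :=
  (ν ⊗ₘ κ.condKernel.comap π hπ).map Prod.swap

theorem compProd_condKernel_of_map_fst (h : κ.map Prod.fst = μ) : μ ⊗ₘ κ.condKernel = κ := by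
  have hdis := κ.disintegrate κ.condKernel
  rwa [Measure.fst, h] at hdis

theorem setLIntegral_condKernel_of_map_fst [SFinite μ] (h : κ.map Prod.fst = μ) {B : Set X}
    {A : Set Z} (hB : MeasurableSet B) (hA : MeasurableSet A) :
    ∫⁻ x in B, κ.condKernel x A ∂μ = κ (B ×ˢ A) := by
  conv_rhs => rw [← compProd_condKernel_of_map_fst h, Measure.compProd_apply_prod hB hA]

theorem relIndepExtension_prod [SFinite ν] (hπ : Measurable π) {A : Set Z} {E : Set W}
    (hA : MeasurableSet A) (hE : MeasurableSet E) :
    relIndepExtension κ ν π hπ (A ×ˢ E) = ∫⁻ y in E, κ.condKernel (π y) A ∂ν := by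
  rw [relIndepExtension, Measure.map_apply measurable_swap (hA.prod hE), Set.preimage_swap_prod,
    Measure.compProd_apply_prod hE hA]
  rfl

theorem relIndepExtension_prod_preimage [SFinite μ] [SFinite ν] (hκ : κ.map Prod.fst = μ)
    (hπ : MeasurePreserving π ν μ) {A : Set Z} {B : Set X} (hA : MeasurableSet A)
    (hB : MeasurableSet B) :
    relIndepExtension κ ν π hπ.measurable (A ×ˢ (π ⁻¹' B)) = κ (B ×ˢ A) := by
  rw [relIndepExtension_prod hπ.measurable hA (hπ.measurable hB),
    hπ.setLIntegral_comp_preimage hB (κ.condKernel.measurable_coe hA),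
    setLIntegral_condKernel_of_map_fst hκ hB hA]

theorem map_fst_relIndepExtension [SFinite μ] [SFinite ν] (hκ : κ.map Prod.fst = μ)
    (hπ : MeasurePreserving π ν μ) :
    (relIndepExtension κ ν π hπ.measurable).map Prod.fst = κ.map Prod.snd := by
  ext A hA
  rw [Measure.map_apply measurable_fst hA, ← Set.prod_univ, ← Set.preimage_univ (f := π),
    relIndepExtension_prod_preimage hκ hπ hA MeasurableSet.univ, Set.univ_prod,
    ← Measure.map_apply measurable_snd hA]

theorem map_snd_relIndepExtension [SFinite ν] (hπ : Measurable π) :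
    (relIndepExtension κ ν π hπ).map Prod.snd = ν := by
  rw [relIndepExtension, Measure.map_map measurable_snd measurable_swap]
  exact Measure.fst_compProd ν _

theorem IsJoining.ae_condKernel_preimage_eq [SigmaFinite μ] {T : X ≃ᵐ X} {R : Z → Z}
    (hT : MeasurePreserving T μ μ) (hR : Measurable R) (hκ : IsJoining T μ R ρ κ) {A : Set Z}
    (hA : MeasurableSet A) :
    ∀ᵐ x ∂μ, κ.condKernel x (R ⁻¹' A) = κ.condKernel (T x) A := by
  refine ae_eq_of_forall_setLIntegral_eq_of_sigmaFinite (κ.condKernel.measurable_coe (hR hA))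
    ((κ.condKernel.measurable_coe hA).comp T.measurable) fun B hB _ => ?_
  obtain ⟨B, rfl⟩ : ∃ B', B = T ⁻¹' B' := ⟨T.symm ⁻¹' B, by ext; simp⟩
  have hB' : MeasurableSet B := T.measurableSet_preimage.1 hB
  calc ∫⁻ x in T ⁻¹' B, κ.condKernel x (R ⁻¹' A) ∂μ
      = κ (Prod.map T R ⁻¹' (B ×ˢ A)) :=
        setLIntegral_condKernel_of_map_fst hκ.map_fst hB (hR hA)
    _ = κ (B ×ˢ A) := hκ.invariant.measure_preimage (hB'.prod hA).nullMeasurableSet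
    _ = ∫⁻ x in B, κ.condKernel x A ∂μ :=
        (setLIntegral_condKernel_of_map_fst hκ.map_fst hB' hA).symm
    _ = ∫⁻ x in T ⁻¹' B, κ.condKernel (T x) A ∂μ :=
        (hT.setLIntegral_comp_preimage hB' (κ.condKernel.measurable_coe hA)).symm

theorem IsJoining.relIndepExtension [IsFiniteMeasure μ] [IsFiniteMeasure ν] {T : X ≃ᵐ X}
    {R : Z → Z} {S : W → W} (hT : MeasurePreserving T μ μ) (hR : Measurable R)
    (hS : MeasurePreserving S ν ν) (hκ : IsJoining T μ R ρ κ) (hπ : IsFactorMap S ν T μ π) :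
    IsJoining R ρ S ν
      (JoiningPrimeness.relIndepExtension κ ν π hπ.measurePreserving.measurable) := by
  have hπm := hπ.measurePreserving
  have hfin : IsFiniteMeasure (JoiningPrimeness.relIndepExtension κ ν π hπm.measurable) :=
    Measure.isFiniteMeasure_map _ _
  have hRS : Measurable (Prod.map R S) := hR.prodMap hS.measurable
  refine ⟨(map_fst_relIndepExtension hκ.map_fst hπm).trans hκ.map_snd,
    map_snd_relIndepExtension hπm.measurable, hRS, ?_⟩
  refine Measure.ext_prod fun {A E} hA hE => ?_
  rw [Measure.map_apply hRS (hA.prod hE)]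
  calc JoiningPrimeness.relIndepExtension κ ν π hπm.measurable ((R ⁻¹' A) ×ˢ (S ⁻¹' E))
      = ∫⁻ y in S ⁻¹' E, κ.condKernel (π y) (R ⁻¹' A) ∂ν :=
        relIndepExtension_prod hπm.measurable (hR hA) (hS.measurable hE)
    _ = ∫⁻ y in S ⁻¹' E, κ.condKernel (π (S y)) A ∂ν := by
        refine lintegral_congr_ae (ae_restrict_of_ae ?_)
        filter_upwards [hπm.quasiMeasurePreserving.ae (hκ.ae_condKernel_preimage_eq hT hR hA),
          hπ.equivariant] with y hy hequiv
        rw [hy, ← Function.comp_apply (f := T), ← hequiv, Function.comp_apply]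
    _ = ∫⁻ y in E, κ.condKernel (π y) A ∂ν :=
        hS.setLIntegral_comp_preimage hE
          ((κ.condKernel.measurable_coe hA).comp hπm.measurable)
    _ = JoiningPrimeness.relIndepExtension κ ν π hπm.measurable (A ×ˢ E) :=
        (relIndepExtension_prod hπm.measurable hA hE).symm

end RelativelyIndependentExtension

section Decorrelation

open scoped symmDiff

theorem integral_abs_sum_sub_le {Ω ι : Type*} [MeasurableSpace Ω] {P : Measure Ω}
    [IsProbabilityMeasure P] [Fintype ι] {X : ι → Ω → ℝ} (hX : ∀ i, Measurable (X i))
    (hX01 : ∀ i ω, X i ω ∈ Set.Icc (0 : ℝ) 1) {c : ℝ} (hc : ∀ i, ∫ ω, X i ω ∂P = c)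
    (hindep : Pairwise fun i j => IndepFun (X i) (X j) P) :
    ∫ ω, |∑ i, X i ω - Fintype.card ι * c| ∂P ≤ √(Fintype.card ι) := by
  have hXL (i : ι) : MemLp (X i) 2 P :=
    MemLp.of_bound (hX i).aestronglyMeasurable 1 (ae_of_all _ fun ω => by
      simpa [abs_of_nonneg (hX01 i ω).1] using (hX01 i ω).2)
  set V : Ω → ℝ := ∑ i, X i with hV
  have hVL : MemLp V 2 P := memLp_finsetSum' _ fun i _ => hXL i
  have hVint : ∫ ω, V ω ∂P = Fintype.card ι * c := by
    simp only [hV, Finset.sum_apply]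
    rw [integral_finsetSum _ fun i _ => (hXL i).integrable one_le_two]
    simp [hc]
  have hVc : MemLp (fun ω => |V ω - Fintype.card ι * c|) 2 P := (hVL.sub (memLp_const _)).abs
  have hvar : ∫ ω, |V ω - Fintype.card ι * c| ^ 2 ∂P ≤ Fintype.card ι := by
    calc ∫ ω, |V ω - Fintype.card ι * c| ^ 2 ∂P = Var[V; P] := by
          simp only [variance_eq_integral hVL.aestronglyMeasurable.aemeasurable, hVint, sq_abs]
      _ = ∑ i, Var[X i; P] :=
          IndepFun.variance_sum (fun i _ => hXL i) (fun i _ j _ hij => hindep hij)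
      _ ≤ ∑ _i : ι, (1 : ℝ) := Finset.sum_le_sum fun i _ =>
          (variance_le_sq_of_bounded (ae_of_all _ (hX01 i)) (hX i).aemeasurable).trans
            (by norm_num)
      _ = Fintype.card ι := by simp
  have hjensen := variance_nonneg (fun ω => |V ω - Fintype.card ι * c|) P
  rw [variance_eq_sub hVc] at hjensen
  simp only [Pi.pow_apply] at hjensen
  simp only [← Finset.sum_apply, ← hV]
  exact Real.le_sqrt_of_sq_le (by linarith)

theorem norm_setIntegral_sub_setIntegral_le {Ω E : Type*} [MeasurableSpace Ω] {P : Measure Ω}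
    [IsFiniteMeasure P] [NormedAddCommGroup E] [NormedSpace ℝ E] {g : Ω → E}
    (hg : Integrable g P) {b : ℝ} (hb : ∀ x, ‖g x‖ ≤ b) {s t : Set Ω} (hs : MeasurableSet s)
    (ht : MeasurableSet t) :
    ‖∫ x in s, g x ∂P - ∫ x in t, g x ∂P‖ ≤ b * P.real (s ∆ t) := by
  rw [← integral_indicator hs, ← integral_indicator ht,
    ← integral_sub (hg.indicator hs) (hg.indicator ht)]
  calc ‖∫ x, s.indicator g x - t.indicator g x ∂P‖
      ≤ ∫ x, (s ∆ t).indicator (fun _ => b) x ∂P := by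
        refine norm_integral_le_of_norm_le ((integrable_const b).indicator (hs.symmDiff ht))
          (ae_of_all _ fun x => ?_)
        rw [← Set.apply_indicator_symmDiff norm_neg, norm_indicator_eq_indicator_norm]
        exact Set.indicator_le_indicator (hb x)
    _ = b * P.real (s ∆ t) := by
        rw [integral_indicator_const _ (hs.symmDiff ht), smul_eq_mul, mul_comm]

theorem norm_setIntegral_sub_setIntegral_comp_le {Ω E : Type*} [MeasurableSpace Ω]
    {P : Measure Ω} [IsFiniteMeasure P] [NormedAddCommGroup E] [NormedSpace ℝ E] {f : Ω → Ω}
    (hf : MeasurePreserving f P P) {g : Ω → E} (hg : Integrable g P) {b : ℝ}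
    (hb : ∀ x, ‖g x‖ ≤ b) {s : Set Ω} (hs : MeasurableSet s) :
    ‖∫ x in s, g x ∂P - ∫ x in s, g (f x) ∂P‖ ≤ b * P.real ((f ⁻¹' s) ∆ s) := by
  have hmap : ∫ x in s, g x ∂P = ∫ x in f ⁻¹' s, g (f x) ∂P := by
    rw [← setIntegral_map hs (by rw [hf.map_eq]; exact hg.aestronglyMeasurable)
      hf.aemeasurable, hf.map_eq]
  rw [hmap]
  exact norm_setIntegral_sub_setIntegral_le (hf.integrable_comp_of_integrable hg)
    (fun x => hb (f x)) (hf.measurable hs) hs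

theorem abs_sub_measureReal_mul_le_of_average {Ω ι : Type*} [MeasurableSpace Ω] {P : Measure Ω}
    [IsFiniteMeasure P] [Fintype ι] [Nonempty ι] {G : ι → Ω → ℝ} (hG : ∀ i, Integrable (G i) P)
    {E : Set Ω} {a c δ s : ℝ} (hδ : ∀ i, |a - ∫ x in E, G i x ∂P| ≤ δ)
    (hs : ∫ x, |∑ i, G i x - Fintype.card ι * c| ∂P ≤ s) :
    |a - P.real E * c| ≤ δ + s / Fintype.card ι := by
  have hsum : Integrable (fun x => ∑ i, G i x - Fintype.card ι * c) P :=
    (integrable_finsetSum _ fun i _ => hG i).sub (integrable_const _)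
  have haverage : |∫ x in E, (∑ i, G i x - Fintype.card ι * c) ∂P| ≤ s :=
    abs_integral_le_integral_abs.trans
      ((setIntegral_le_integral hsum.abs (ae_of_all _ fun _ => abs_nonneg _)).trans hs)
  have hsplit : Fintype.card ι * (a - P.real E * c) =
      ∑ i, (a - ∫ x in E, G i x ∂P) + ∫ x in E, (∑ i, G i x - Fintype.card ι * c) ∂P := by
    rw [integral_sub (integrable_finsetSum _ fun i _ => (hG i).integrableOn)
      (integrable_const _), integral_finsetSum _ fun i _ => (hG i).integrableOn,
      setIntegral_const, Finset.sum_sub_distrib, Finset.sum_const, Finset.card_univ,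
      nsmul_eq_mul, smul_eq_mul]
    ring
  have hpos : (0 : ℝ) < Fintype.card ι := by exact_mod_cast Fintype.card_pos
  refine le_of_mul_le_mul_left ?_ hpos
  calc Fintype.card ι * |a - P.real E * c|
      = |Fintype.card ι * (a - P.real E * c)| := by rw [abs_mul, abs_of_pos hpos]
    _ ≤ ∑ _i : ι, δ + s := by
        rw [hsplit]
        exact (abs_add_le _ _).trans (add_le_add ((Finset.abs_sum_le_sum_abs _ _).trans
          (Finset.sum_le_sum fun i _ => hδ i)) haverage)
    _ = Fintype.card ι * (δ + s / Fintype.card ι) := by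
        rw [Finset.sum_const, Finset.card_univ, nsmul_eq_mul, mul_add, mul_div_cancel₀ _ hpos.ne']

theorem exists_perm_pairwise_disjoint_range {ι : Type*} [Fintype ι] (I : Finset ι) {m : ℕ}
    (hcard : m * I.card ≤ Fintype.card ι) :
    ∃ σ : Fin m → Equiv.Perm ι,
      Pairwise fun j l => Disjoint (Set.range fun i : I => σ j i)
        (Set.range fun i : I => σ l i) := by
  obtain ⟨φ⟩ : Nonempty (Fin m × I ↪ ι) :=
    Function.Embedding.nonempty_of_card_le (by simpa using hcard)
  have hextend (j : Fin m) : ∃ σ : Equiv.Perm ι, ∀ i : I, σ i = φ (j, i) :=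
    Equiv.Perm.exists_extending_pair (fun i : I => (i : ι)) (fun i : I => φ (j, i))
      Subtype.val_injective fun a b hab => (Prod.ext_iff.1 (φ.injective hab)).2
  choose σ hσ using hextend
  refine ⟨σ, fun j l hjl => ?_⟩
  simp only [hσ, Set.disjoint_range_iff]
  exact fun i i' h => hjl (Prod.ext_iff.1 (φ.injective h)).1

theorem indepFun_pi_reindex {ι J J' : Type*} [Fintype ι] [Finite J] [Finite J'] {Y : ι → Type*}
    [∀ i, MeasurableSpace (Y i)] (ν : ∀ i, Measure (Y i)) [∀ i, IsProbabilityMeasure (ν i)]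
    {a : J → ι} {b : J' → ι} (hab : Disjoint (Set.range a) (Set.range b)) :
    IndepFun (fun (y : ∀ i, Y i) j => y (a j)) (fun y j => y (b j)) (Measure.pi ν) := by
  have hcoord : iIndepFun (fun i (y : ∀ i, Y i) => y i) (Measure.pi ν) :=
    iIndepFun_pi (X := fun _ => id) fun _ => aemeasurable_id
  set s := (Set.finite_range a).toFinset with hs
  set t := (Set.finite_range b).toFinset with ht
  have has (j : J) : a j ∈ s := (Set.finite_range a).mem_toFinset.2 (Set.mem_range_self j)
  have hbt (j : J') : b j ∈ t := (Set.finite_range b).mem_toFinset.2 (Set.mem_range_self j)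
  have hst : Disjoint s t := by simpa [hs, ht, ← Finset.disjoint_coe] using hab
  exact (hcoord.indepFun_finset s t hst fun i => measurable_pi_apply i).comp
    (φ := fun v j => v ⟨a j, has j⟩) (ψ := fun v j => v ⟨b j, hbt j⟩)
    (measurable_pi_lambda _ fun _ => measurable_pi_apply _)
    (measurable_pi_lambda _ fun _ => measurable_pi_apply _)

variable {ι Y : Type*} [Fintype ι] [MeasurableSpace Y] (ν : Measure Y) [IsProbabilityMeasure ν]

theorem measurePreserving_comp_perm (σ : Equiv.Perm ι) :
    MeasurePreserving (fun y : ι → Y => y ∘ σ) (Measure.pi fun _ => ν) (Measure.pi fun _ => ν) :=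
  measurePreserving_arrowCongr' (fun _ => ν) (fun _ => ν) σ.symm (MeasurableEquiv.refl Y)
    fun _ => MeasurePreserving.id ν

theorem exists_perm_integral_abs_sum_sub_le {I : Finset ι} {m : ℕ}
    (hcard : m * I.card ≤ Fintype.card ι) {H : (I → Y) → ℝ} (hH : Measurable H)
    (hH01 : ∀ v, H v ∈ Set.Icc (0 : ℝ) 1) :
    ∃ σ : Fin m → Equiv.Perm ι,
      ∫ y : ι → Y, |∑ j, H (fun i => y (σ j i)) -
        m * ∫ y : ι → Y, H (fun i => y i) ∂Measure.pi fun _ => ν| ∂Measure.pi (fun _ => ν)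
        ≤ √m := by
  obtain ⟨σ, hσ⟩ := exists_perm_pairwise_disjoint_range I hcard
  have hcopy (τ : Equiv.Perm ι) : Measurable fun y : ι → Y => H fun i => y (τ i) :=
    hH.comp (measurable_pi_lambda _ fun i => measurable_pi_apply _)
  have hmean (j : Fin m) : ∫ y : ι → Y, H (fun i => y (σ j i)) ∂Measure.pi (fun _ => ν) =
      ∫ y : ι → Y, H (fun i => y i) ∂Measure.pi fun _ => ν := by
    have hpres := measurePreserving_comp_perm ν (σ j)
    refine (integral_map hpres.aemeasurable (hcopy 1).aestronglyMeasurable).symm.trans ?_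
    rw [hpres.map_eq]
    rfl
  refine ⟨σ, ?_⟩
  simpa using integral_abs_sum_sub_le (fun j => hcopy (σ j)) (fun _ _ => hH01 _) hmean
    fun j l hjl => (indepFun_pi_reindex (fun _ => ν) (hσ hjl)).comp hH hH

/-- `H` has many independent copies under permutations of the coordinates, and the average of
these copies is close to its mean. An almost symmetric set correlates with each copy almost as
with `H` itself. -/
theorem abs_setIntegral_sub_le_of_almost_symmetric {I : Finset ι} {m : ℕ} (hm : m ≠ 0)
    (hcard : m * I.card ≤ Fintype.card ι) {E : Set (ι → Y)} (hE : MeasurableSet E) {δ : ℝ}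
    (hδ : ∀ σ : Equiv.Perm ι,
      (Measure.pi fun _ => ν).real (((fun y : ι → Y => y ∘ σ) ⁻¹' E) ∆ E) ≤ δ)
    {H : (I → Y) → ℝ} (hH : Measurable H) (hH01 : ∀ v, H v ∈ Set.Icc (0 : ℝ) 1) :
    |∫ y in E, H (fun i => y i) ∂Measure.pi (fun _ => ν) -
      (Measure.pi fun _ => ν).real E * ∫ y : ι → Y, H (fun i => y i) ∂Measure.pi fun _ => ν|
      ≤ δ + (√m)⁻¹ := by
  obtain ⟨σ, hσ⟩ := exists_perm_integral_abs_sum_sub_le ν hcard hH hH01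
  have : NeZero m := ⟨hm⟩
  have hint (τ : Equiv.Perm ι) :
      Integrable (fun y : ι → Y => H fun i => y (τ i)) (Measure.pi fun _ => ν) :=
    Integrable.of_mem_Icc 0 1
      (hH.comp (measurable_pi_lambda _ fun i => measurable_pi_apply _)).aemeasurable
      (ae_of_all _ fun y => hH01 _)
  have hshift (j : Fin m) : |∫ y in E, H (fun i => y i) ∂Measure.pi (fun _ => ν) -
      ∫ y in E, H (fun i => y (σ j i)) ∂Measure.pi (fun _ => ν)| ≤ δ := by
    refine (norm_setIntegral_sub_setIntegral_comp_le (measurePreserving_comp_perm ν (σ j))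
      (hint 1) (b := 1) (fun y => ?_) hE).trans ((one_mul _).trans_le (hδ (σ j)))
    exact (abs_of_nonneg (hH01 _).1).trans_le (hH01 _).2
  rw [← one_div, ← Real.sqrt_div_self']
  simpa using
    abs_sub_measureReal_mul_le_of_average (fun j => hint (σ j)) hshift (by simpa using hσ)

end Decorrelation

section IndepExtension

theorem exists_measurable_withDensity_eq_of_le {Ω : Type*} [MeasurableSpace Ω] {μ ν : Measure Ω}
    [SigmaFinite μ] [SigmaFinite ν] (hle : μ ≤ ν) :
    ∃ d : Ω → ℝ≥0∞, Measurable d ∧ (∀ x, d x ≤ 1) ∧ μ = ν.withDensity d := by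
  refine ⟨fun x => min (μ.rnDeriv ν x) 1, (Measure.measurable_rnDeriv _ _).min measurable_const,
    fun x => min_le_right _ _, ?_⟩
  conv_lhs => rw [← Measure.withDensity_rnDeriv_eq μ ν (Measure.absolutelyContinuous_of_le hle)]
  refine withDensity_congr_ae ?_
  filter_upwards [Measure.rnDeriv_le_one_of_le hle] with x hx
  exact (min_eq_left hx).symm

variable {Z : Type*} [MeasurableSpace Z] {k : ℕ} {Y : Fin k → Type*}
  [∀ i, MeasurableSpace (Y i)] {ν : ∀ i, Measure (Y i)} {l : Measure (Z × ∀ i, Y i)}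
  {I : Finset (Fin k)}

theorem IsIndepExtension.map_restrict_eq_prod [∀ i, SigmaFinite (ν i)] [SFinite l]
    (hI : IsIndepExtension ν l I) {A : Set Z} (hA : MeasurableSet A) :
    (l.restrict (A ×ˢ Set.univ)).map (fun p => (fun i : {i // i ∈ I} => p.2 i,
        fun j : {j // j ∉ I} => p.2 j)) =
      ((l.restrict (A ×ˢ Set.univ)).map fun p => fun i : {i // i ∈ I} => p.2 i).prod
        (Measure.pi fun j : {j // j ∉ I} => ν j) := by
  have hfst : Measurable fun p : Z × ∀ i, Y i => (p.1, fun i : {i // i ∈ I} => p.2 i) := by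
    fun_prop
  have hboth : Measurable fun p : Z × ∀ i, Y i =>
      ((p.1, fun i : {i // i ∈ I} => p.2 i), fun j : {j // j ∉ I} => p.2 j) := by
    fun_prop
  have hAu : MeasurableSet (A ×ˢ (Set.univ : Set (∀ i : {i // i ∈ I}, Y i))) := hA.prod .univ
  have hrestrict := congrArg (fun q => q.restrict ((A ×ˢ Set.univ) ×ˢ Set.univ)) hI
  simp only [← Measure.prod_restrict, Measure.restrict_univ, Measure.restrict_map hfst hAu,
    Measure.restrict_map hboth (hAu.prod .univ), Set.mk_preimage_prod, Set.preimage_univ,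
    Set.inter_univ, ← Set.prod_univ] at hrestrict
  have hforget := congrArg (Measure.map (Prod.map Prod.snd id)) hrestrict
  rwa [Measure.map_map (by fun_prop) hboth, ← Measure.map_prod_map _ _ measurable_snd measurable_id,
    Measure.map_map measurable_snd hfst, Measure.map_id] at hforget

theorem map_withDensity_comp_of_measurePreserving {Ω Ω' : Type*} [MeasurableSpace Ω]
    [MeasurableSpace Ω'] {μ : Measure Ω} {μ' : Measure Ω'} {f : Ω → Ω'}
    (hf : MeasurePreserving f μ μ') {d : Ω' → ℝ≥0∞} (hd : Measurable d) :
    (μ.withDensity (d ∘ f)).map f = μ'.withDensity d := by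
  ext E hE
  rw [Measure.map_apply hf.measurable hE, withDensity_apply _ (hf.measurable hE),
    withDensity_apply _ hE]
  exact hf.setLIntegral_comp_preimage hE hd

theorem measurePreserving_piEquivPiSubtypeProd_finset [∀ i, SigmaFinite (ν i)]
    (I : Finset (Fin k)) :
    MeasurePreserving (MeasurableEquiv.piEquivPiSubtypeProd Y (· ∈ I)) (Measure.pi ν)
      ((Measure.pi fun i : {i // i ∈ I} => ν i).prod
        (Measure.pi fun j : {j // j ∉ I} => ν j)) := by
  convert measurePreserving_piEquivPiSubtypeProd ν (· ∈ I)

theorem measurePreserving_pi_finset_restrict [∀ i, IsProbabilityMeasure (ν i)]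
    (I : Finset (Fin k)) :
    MeasurePreserving (fun (y : ∀ i, Y i) (i : {i // i ∈ I}) => y i) (Measure.pi ν)
      (Measure.pi fun i : {i // i ∈ I} => ν i) :=
  measurePreserving_fst.comp (measurePreserving_piEquivPiSubtypeProd_finset I)

theorem IsIndepExtension.exists_map_restrict_eq_withDensity [∀ i, IsProbabilityMeasure (ν i)]
    [IsFiniteMeasure l] (hsnd : l.map Prod.snd = Measure.pi ν) (hI : IsIndepExtension ν l I)
    {A : Set Z} (hA : MeasurableSet A) :
    ∃ d : (∀ i : {i // i ∈ I}, Y i) → ℝ≥0∞, Measurable d ∧ (∀ v, d v ≤ 1) ∧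
      (l.restrict (A ×ˢ Set.univ)).map Prod.snd =
        (Measure.pi ν).withDensity fun y => d fun i => y i := by
  have hres := measurePreserving_pi_finset_restrict (ν := ν) I
  have hle : (l.restrict (A ×ˢ Set.univ)).map (fun p (i : {i // i ∈ I}) => p.2 i) ≤
      Measure.pi fun i : {i // i ∈ I} => ν i := by
    rw [← hres.map_eq, ← hsnd, Measure.map_map hres.measurable measurable_snd]
    exact Measure.map_mono Measure.restrict_le_self (hres.measurable.comp measurable_snd)
  obtain ⟨d, hd, hd1, hdensity⟩ := exists_measurable_withDensity_eq_of_le hle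
  refine ⟨d, hd, hd1, ?_⟩
  have hsplit := measurePreserving_piEquivPiSubtypeProd_finset (ν := ν) I
  refine (MeasurableEquiv.piEquivPiSubtypeProd Y (· ∈ I)).map_measurableEquiv_injective ?_
  calc ((l.restrict (A ×ˢ Set.univ)).map Prod.snd).map _
      = (l.restrict (A ×ˢ Set.univ)).map _ := Measure.map_map hsplit.measurable measurable_snd
    _ = ((Measure.pi fun i : {i // i ∈ I} => ν i).withDensity d).prod
          (Measure.pi fun j : {j // j ∉ I} => ν j) := by
        rw [← hdensity]
        exact hI.map_restrict_eq_prod hA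
    _ = _ := (prod_withDensity_left hd).trans
        (map_withDensity_comp_of_measurePreserving hsplit (hd.comp measurable_fst)).symm

theorem IsIndepExtension.exists_measureReal_prod_eq_setIntegral
    [∀ i, IsProbabilityMeasure (ν i)] [IsFiniteMeasure l] (hsnd : l.map Prod.snd = Measure.pi ν)
    (hI : IsIndepExtension ν l I) {A : Set Z} (hA : MeasurableSet A) :
    ∃ H : (∀ i : {i // i ∈ I}, Y i) → ℝ, Measurable H ∧ (∀ v, H v ∈ Set.Icc (0 : ℝ) 1) ∧
      ∀ E, MeasurableSet E → l.real (A ×ˢ E) = ∫ y in E, H (fun i => y i) ∂Measure.pi ν := by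
  obtain ⟨d, hd, hd1, hdensity⟩ := hI.exists_map_restrict_eq_withDensity hsnd hA
  refine ⟨fun v => (d v).toReal, hd.ennreal_toReal, fun v => ⟨ENNReal.toReal_nonneg, ?_⟩,
    fun E hE => ?_⟩
  · exact ENNReal.toReal_le_of_le_ofReal zero_le_one (by simpa using hd1 v)
  have hprod : l (A ×ˢ E) = ((l.restrict (A ×ˢ Set.univ)).map Prod.snd) E := by
    rw [Measure.map_apply measurable_snd hE, Measure.restrict_apply (measurable_snd hE),
      Set.inter_comm, Set.prod_eq A E, Set.prod_univ]
  rw [measureReal_def, hprod, hdensity, withDensity_apply _ hE]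
  refine (integral_toReal ?_ (ae_of_all _ fun y => (hd1 _).trans_lt ENNReal.one_lt_top)).symm
  exact (hd.comp (measurePreserving_pi_finset_restrict (ν := ν) I).measurable).aemeasurable

end IndepExtension

section NearSymmetry

open scoped symmDiff

variable {𝕜 Y : Type*} [RCLike 𝕜] [MeasurableSpace Y] {k : ℕ} {ν : Measure Y}
  [IsProbabilityMeasure ν]

theorem compMeasurePreserving_perm_eq_of_mem_lpMeas
    {G : Lp 𝕜 2 (Measure.pi fun _ : Fin k => ν)}
    (hG : G ∈ lpMeas 𝕜 𝕜 (symmetricFactor Y k) 2 (Measure.pi fun _ : Fin k => ν))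
    (σ : Equiv.Perm (Fin k)) :
    Lp.compMeasurePreserving (fun y : Fin k → Y => y ∘ σ) (measurePreserving_comp_perm ν σ) G =
      G := by
  obtain ⟨g, hg, hGg⟩ := mem_lpMeas_iff_aestronglyMeasurable.1 hG
  have hσ := measurePreserving_comp_perm ν σ
  have hinv (y : Fin k → Y) : g (y ∘ σ) = g y := by
    have hpre := (hg.measurable (measurableSet_singleton (g y))).2 σ
    exact hpre.ge rfl
  refine Lp.ext ((Lp.coeFn_compMeasurePreserving G hσ).trans ?_)
  refine (hσ.quasiMeasurePreserving.ae_eq_comp hGg).trans (EventuallyEq.trans ?_ hGg.symm)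
  exact .of_forall hinv

theorem dist_compMeasurePreserving_perm_le (G : Lp 𝕜 2 (Measure.pi fun _ : Fin k => ν))
    (σ : Equiv.Perm (Fin k)) :
    dist (Lp.compMeasurePreserving (fun y : Fin k → Y => y ∘ σ)
      (measurePreserving_comp_perm ν σ) G) G ≤ 2 * distSymmetric G := by
  rw [← div_le_iff₀' two_pos, distSymmetric]
  refine (Metric.le_infDist ⟨0, Submodule.zero_mem _⟩).2 fun {G'} hG' => ?_
  have hσ := measurePreserving_comp_perm ν σ
  rw [div_le_iff₀' two_pos]
  calc dist (Lp.compMeasurePreserving _ hσ G) G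
      ≤ dist (Lp.compMeasurePreserving _ hσ G) (Lp.compMeasurePreserving _ hσ G') +
          dist (Lp.compMeasurePreserving _ hσ G') G := dist_triangle _ _ _
    _ = 2 * dist G G' := by
        rw [(Lp.isometry_compMeasurePreserving hσ).dist_eq,
          compMeasurePreserving_perm_eq_of_mem_lpMeas hG', dist_comm G' G, two_mul]

theorem measureReal_symmDiff_perm_le {E : Set (Fin k → Y)} (hE : MeasurableSet E)
    (σ : Equiv.Perm (Fin k)) :
    (Measure.pi fun _ => ν).real (((fun y : Fin k → Y => y ∘ σ) ⁻¹' E) ∆ E) ≤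
      (2 * distSymmetric (indicatorConstLp 2 hE
        (measure_ne_top (Measure.pi fun _ : Fin k => ν) E) (1 : 𝕜))) ^ 2 := by
  have hdist := dist_compMeasurePreserving_perm_le
    (indicatorConstLp 2 hE (measure_ne_top (Measure.pi fun _ : Fin k => ν) E) (1 : 𝕜)) σ
  rw [Lp.indicatorConstLp_compMeasurePreserving, dist_indicatorConstLp_eq_norm,
    norm_indicatorConstLp two_ne_zero ENNReal.ofNat_ne_top, norm_one, one_mul] at hdist
  rw [ENNReal.toReal_ofNat, ← Real.sqrt_eq_rpow] at hdist
  exact (Real.sqrt_le_iff.1 hdist).2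

end NearSymmetry

section JoiningPrimenessBound

open scoped symmDiff

variable {Z : Type v} {Y : Type w} [MeasurableSpace Z] [MeasurableSpace Y] {ρ : Measure Z}
  {ν : Measure Y} [IsProbabilityMeasure ν] {k m : ℕ} {l : Measure (Z × (Fin k → Y))} {A : Set Z}
  {E : Set (Fin k → Y)} {δ : ℝ}

theorem IsIndepExtension.abs_measureReal_prod_sub_le [IsFiniteMeasure l]
    (hfst : l.map Prod.fst = ρ) (hsnd : l.map Prod.snd = Measure.pi fun _ => ν)
    {I : Finset (Fin k)} (hI : IsIndepExtension (fun _ => ν) l I) (hm : m ≠ 0)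
    (hcard : m * I.card ≤ k) (hA : MeasurableSet A) (hE : MeasurableSet E)
    (hδ : ∀ σ : Equiv.Perm (Fin k),
      (Measure.pi fun _ => ν).real (((fun y : Fin k → Y => y ∘ σ) ⁻¹' E) ∆ E) ≤ δ) :
    |l.real (A ×ˢ E) - ρ.real A * (Measure.pi fun _ => ν).real E| ≤ δ + (√m)⁻¹ := by
  obtain ⟨H, hH, hH01, hdensity⟩ := hI.exists_measureReal_prod_eq_setIntegral hsnd hA
  have hmean : ρ.real A = ∫ y : Fin k → Y, H (fun i => y i) ∂Measure.pi fun _ => ν := by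
    rw [← hfst, map_measureReal_apply measurable_fst hA, ← Set.prod_univ, hdensity _ .univ,
      Measure.restrict_univ]
  rw [hdensity E hE, hmean, mul_comm]
  exact abs_setIntegral_sub_le_of_almost_symmetric ν hm (by simpa using hcard) hE hδ hH hH01

variable [StandardBorelSpace Z] [StandardBorelSpace Y] [IsProbabilityMeasure ρ] {n : ℕ}
  {R : Z ≃ᵐ Z} {S : Y ≃ᵐ Y}

/-- `JP n` applies to ergodic joinings only; the estimate is linear in the joining, so it passes to
the ergodic decomposition, whose components are joinings because both marginals are ergodic. -/
theorem JP.abs_measureReal_prod_sub_le (hR : JP.{v, w} n R ρ) (hk : n + 1 ≤ k)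
    (hS : IsWeaklyMixing S ν)
    (hl : IsJoining R ρ (Pi.map fun _ => S) (Measure.pi fun _ => ν) l) (hm : m ≠ 0)
    (hmk : m * n ≤ k) (hA : MeasurableSet A) (hE : MeasurableSet E)
    (hδ : ∀ σ : Equiv.Perm (Fin k),
      (Measure.pi fun _ => ν).real (((fun y : Fin k → Y => y ∘ σ) ⁻¹' E) ∆ E) ≤ δ) :
    |l.real (A ×ˢ E) - ρ.real A * (Measure.pi fun _ => ν).real E| ≤ δ + (√m)⁻¹ := by
  have := hl.isProbabilityMeasure
  refine abs_measureReal_sub_le_of_ae_condExpKernel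
    (MeasurableSpace.invariants_le (Prod.map R (Pi.map fun _ => S))) (hA.prod hE) ?_
  filter_upwards [hl.ae_ergodic_condExpKernel_invariants hR.ergodic
    (ergodic_pi_of_isWeaklyMixing fun _ => hS)] with ω ⟨hjoining, hergodic⟩
  obtain ⟨i, hi⟩ :=
    hR.exists_isIndepExtension k hk _ _ _ (fun _ => hS) _ hjoining hergodic
  have hcard : (Finset.univ.image i).card ≤ n := by
    simpa using Finset.card_image_le (s := Finset.univ) (f := i)
  exact hi.abs_measureReal_prod_sub_le hjoining.map_fst hjoining.map_snd hm
    ((Nat.mul_le_mul_left m hcard).trans hmk) hA hE hδ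

theorem JP.abs_measureReal_joining_sub_le {𝕜 X : Type*} [RCLike 𝕜] [MeasurableSpace X]
    {μ : Measure X} [IsProbabilityMeasure μ] {T : X ≃ᵐ X} (hT : MeasurePreserving T μ μ)
    (hR : JP.{v, w} n R ρ) {κ : Measure (X × Z)} (hκ : IsJoining T μ R ρ κ) (hk : n + 1 ≤ k)
    (hS : IsWeaklyMixing S ν) {π : (Fin k → Y) → X}
    (hπ : IsFactorMap (Pi.map fun _ => S) (Measure.pi fun _ => ν) T μ π) (hm : m ≠ 0)
    (hmk : m * n ≤ k) {B : Set X} (hB : MeasurableSet B) (hA : MeasurableSet A) :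
    |κ.real (B ×ˢ A) - μ.real B * ρ.real A| ≤
      (2 * distSymmetric (Lp.compMeasurePreserving π hπ.measurePreserving
        (indicatorConstLp 2 hB (measure_ne_top μ B) (1 : 𝕜)))) ^ 2 + (√m)⁻¹ := by
  have := hκ.isProbabilityMeasure
  have : Nonempty Z := nonempty_of_isProbabilityMeasure ρ
  have hπm := hπ.measurePreserving
  have hl := hκ.relIndepExtension hT R.measurable
    (measurePreserving_pi (fun _ => ν) (fun _ => ν) fun _ => hS.measurePreserving) hπ
  have hbound := hR.abs_measureReal_prod_sub_le hk hS hl hm hmk hA (hπm.measurable hB)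
    (measureReal_symmDiff_perm_le (𝕜 := 𝕜) (hπm.measurable hB))
  rwa [measureReal_def, relIndepExtension_prod_preimage hκ.map_fst hπm hA hB, ← measureReal_def,
    hπm.measureReal_preimage hB.nullMeasurableSet, mul_comm (ρ.real A)] at hbound

theorem tendsto_of_isLittleO_rpow_of_nonpos {f : ℕ → ℝ} {k : ℕ → ℕ} {s : ℝ} (hs : s ≤ 0)
    (hk : Tendsto k atTop atTop) (hf : f =o[atTop] fun j => (k j : ℝ) ^ s) :
    Tendsto f atTop (𝓝 0) := by
  refine (isLittleO_one_iff ℝ).1 (hf.trans_isBigO (IsBigO.of_bound 1 ?_))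
  filter_upwards [hk.eventually_ge_atTop 1] with j hj
  simpa [abs_of_nonneg (Real.rpow_nonneg (Nat.cast_nonneg _) _)] using
    Real.rpow_le_one_of_one_le_of_nonpos (Nat.one_le_cast.2 hj) hs

end JoiningPrimenessBound

end JoiningPrimeness

theorem mainTheorem7_general {𝕜 : Type*} [RCLike 𝕜] (n : ℕ)
    {X : Type u} [MeasurableSpace X] (μ : Measure X) [IsProbabilityMeasure μ]
    (T : X ≃ᵐ X) (hT : MeasurePreserving T μ μ)
    (happrox : ∀ (B : Set X) (hB : MeasurableSet B),
      ∃ (k : ℕ → ℕ) (Y : ℕ → Type w) (_ : ∀ j, MeasurableSpace (Y j))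
        (_ : ∀ j, StandardBorelSpace (Y j)) (ν : ∀ j, Measure (Y j))
        (_ : ∀ j, IsProbabilityMeasure (ν j)) (S : ∀ j, Y j ≃ᵐ Y j)
        (π : ∀ j, (Fin (k j) → Y j) → X)
        (hπ : ∀ j, IsFactorMap (Pi.map fun _ : Fin (k j) => S j)
          (Measure.pi fun _ : Fin (k j) => ν j) T μ (π j)),
        Tendsto k atTop atTop ∧
        (∀ j, IsWeaklyMixing (S j) (ν j)) ∧
        Tendsto (fun j => distSymmetric (Lp.compMeasurePreserving (π j) (hπ j).measurePreserving
          (indicatorConstLp 2 hB (measure_ne_top μ B) (1 : 𝕜)))) atTop (𝓝 0))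
    {Z : Type v} [MeasurableSpace Z] [StandardBorelSpace Z]
    (ρ : Measure Z) [IsProbabilityMeasure ρ]
    (R : Z ≃ᵐ Z) (hR : JP.{v, w} n R ρ) :
    AreDisjoint T μ R ρ := by
  refine Set.eq_singleton_iff_unique_mem.2
    ⟨⟨Measure.fst_prod, Measure.snd_prod, hT.prod hR.ergodic.toMeasurePreserving⟩,
      fun κ (hκ : IsJoining T μ R ρ κ) => ?_⟩
  have := hκ.isProbabilityMeasure
  refine Measure.ext_prod fun {B A} hB hA => ?_
  obtain ⟨k, Y, _, _, ν, _, S, π, hπ, hk, hS, hdist⟩ := happrox B hB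
  have hkn : Tendsto (fun j => k j / (n + 1)) atTop atTop :=
    (Nat.tendsto_div_const_atTop n.succ_ne_zero).comp hk
  have hbound : ∀ᶠ j in atTop, |κ.real (B ×ˢ A) - μ.real B * ρ.real A| ≤
      (2 * distSymmetric (Lp.compMeasurePreserving (π j) (hπ j).measurePreserving
        (indicatorConstLp 2 hB (measure_ne_top μ B) (1 : 𝕜)))) ^ 2 +
        (√(k j / (n + 1) : ℕ))⁻¹ := by
    filter_upwards [hk.eventually_ge_atTop (n + 1), hkn.eventually_ne_atTop 0] with j hj hj0
    exact hR.abs_measureReal_joining_sub_le (𝕜 := 𝕜) hT hκ hj (hS j) (hπ j) hj0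
      ((Nat.mul_le_mul_left _ n.le_succ).trans (Nat.div_mul_le_self _ _)) hB hA
  have hzero : |κ.real (B ×ˢ A) - μ.real B * ρ.real A| ≤ (2 * 0) ^ 2 + 0 :=
    ge_of_tendsto (((hdist.const_mul 2).pow 2).add (Real.tendsto_sqrt_atTop.comp
      (tendsto_natCast_atTop_atTop.comp hkn)).inv_tendsto_atTop) hbound
  have hreal : κ.real (B ×ˢ A) = (μ.prod ρ).real (B ×ˢ A) := by
    rw [measureReal_prod_prod, ← sub_eq_zero, ← abs_nonpos_iff]
    simpa using hzero
  exact (measureReal_eq_measureReal_iff).1 hreal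

theorem mainTheorem7 {𝕜 : Type*} [RCLike 𝕜] (n : ℕ) (hn : 1 ≤ n)
    {X : Type u} [MeasurableSpace X] [StandardBorelSpace X]
    (μ : Measure X) [IsProbabilityMeasure μ]
    (T : X ≃ᵐ X) (hT : MeasurePreserving T μ μ)
    (happrox : ∀ g : Lp 𝕜 2 μ,
      ∃ (k : ℕ → ℕ) (Y : ℕ → Type w) (_ : ∀ j, MeasurableSpace (Y j))
        (_ : ∀ j, StandardBorelSpace (Y j)) (ν : ∀ j, Measure (Y j))
        (_ : ∀ j, IsProbabilityMeasure (ν j)) (S : ∀ j, Y j ≃ᵐ Y j)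
        (π : ∀ j, (Fin (k j) → Y j) → X)
        (hπ : ∀ j, IsFactorMap (Pi.map fun _ : Fin (k j) => S j)
          (Measure.pi fun _ : Fin (k j) => ν j) T μ (π j)),
        Tendsto k atTop atTop ∧
        (∀ j, IsWeaklyMixing (S j) (ν j)) ∧
        (fun j => distSymmetric (Lp.compMeasurePreserving (π j) (hπ j).measurePreserving g))
          =o[atTop] fun j => (k j : ℝ) ^ (-((n : ℝ) / 2)))
    {Z : Type v} [MeasurableSpace Z] [StandardBorelSpace Z]
    (ρ : Measure Z) [IsProbabilityMeasure ρ]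
    (R : Z ≃ᵐ Z) (hR : JP.{v, w} n R ρ) :
    AreDisjoint T μ R ρ := by
  refine mainTheorem7_general (𝕜 := 𝕜) n μ T hT (fun B hB => ?_) ρ R hR
  obtain ⟨k, Y, _, _, ν, _, S, π, hπ, hk, hS, hdist⟩ := happrox (indicatorConstLp 2 hB _ 1)
  exact ⟨k, Y, _, ‹_›, ν, ‹_›, S, π, hπ, hk, hS,
    tendsto_of_isLittleO_rpow_of_nonpos (neg_nonpos.2 (by positivity)) hk hdist⟩
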